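/- For a metric space $(X,d)$, the Nagata dimension $\operatorname{ndim} X$ is the infimum of all integers $n$ with the following property: there is a constant $c>0$ such that for every $s>0$ the space $X$ has a covering $\mathcal B$ by subsets of diameter at most $cs$ such that every subset of $X$ of diameter at most $s$ meets at most $n+1$ members of $\mathcal B$. (Here $n+1\ge 0$; the infimum of the empty set is $+\infty$, and the empty space has dimension $-1$.) Subsets of $\mathbb C$ carry the Euclidean metric $|z-w|$. **Theorem.** Let $f$ be a non-constant polynomial with complex coefficients. Then $\operatorname{ndim} f(X)=\operatorname{ndim} X$ for every subset $X\subset\mathbb C$. -/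

import Mathlib

open scoped ENNReal

/-- A family `𝓑` of subsets of a metric space is `s`-bounded if every member has diameter at most
`s`. The diameter is taken in `[0, ∞]`, so unbounded sets have diameter `∞`. -/
def IsBoundedFamily {X : Type*} [MetricSpace X] (s : ℝ) (𝓑 : Set (Set X)) : Prop :=
  ∀ B ∈ 𝓑, Metric.ediam B ≤ ENNReal.ofReal s

/-- The `s`-multiplicity of a family `𝓑`: the infimum of all integers `k ≥ 0` such that every
subset of diameter at most `s` meets at most `k` members of `𝓑` (it is `∞` if there is no
such `k`). -/
noncomputable def sMultiplicity {X : Type*} [MetricSpace X] (s : ℝ) (𝓑 : Set (Set X)) : ℕ∞ :=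
  ⨅ (k : ℕ) (_ : ∀ A : Set X, Metric.ediam A ≤ ENNReal.ofReal s →
    {B ∈ 𝓑 | (B ∩ A).Nonempty}.encard ≤ (k : ℕ∞)), (k : ℕ∞)

/-- There is a constant `c > 0` such that for all `s > 0` the space `X` admits a `c * s`-bounded
covering with `s`-multiplicity at most `n + 1`. As a multiplicity is nonnegative, this forces
`n ≥ -1`. -/
def HasNagataBound (X : Type*) [MetricSpace X] (n : ℤ) : Prop :=
  ∃ c : ℝ, 0 < c ∧ ∀ s : ℝ, 0 < s → ∃ 𝓑 : Set (Set X),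
    ⋃₀ 𝓑 = Set.univ ∧ IsBoundedFamily (c * s) 𝓑 ∧
      ∃ k : ℕ, (k : ℤ) ≤ n + 1 ∧ sMultiplicity s 𝓑 ≤ (k : ℕ∞)

/-- The Nagata dimension of a metric space: the infimum, in the extended reals, of all integers
`n` with `HasNagataBound X n`. It is `⊤` if there is no such `n`, and `-1` for the empty space. -/
noncomputable def ndim (X : Type*) [MetricSpace X] : EReal :=
  ⨅ (n : ℤ) (_ : HasNagataBound X n), ((n : ℝ) : EReal)

-- Nagata dimension at most `n` is equivalent to a coloured condition: at every scale `n + 1` sets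
-- cover the space, each splitting into classes that are bounded and mutually separated relative to
-- the scale (`hasNagataBound_iff_colorBound`). This form survives finite unions, since classes of
-- one set can be absorbed into classes of another (`ColorBound.union`).
--
-- It also survives pulling back along a map that is bilipschitz only up to a scaling factor varying
-- from piece to piece, provided the pieces are small and well separated relative to their distance
-- to one point (`ColorBound.transfer`): pieces near that point form a single class, and the rest do
-- not interact.
--
-- A polynomial has this structure away from the fibres over a finite set `V` containing the
-- critical values. On a disc whose radius is a small multiple of the distance to the preimage of
-- `V`, the derivative is nearly constant, so the map is a scaled bilipschitz map
-- (`exists_distortion`). A Whitney-type decomposition of the complement of `V`, split into finitely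
-- many well-separated families and lifted through the finite fibres, gives `exists_sheets`.
-- Transfer along the polynomial and along sections of it yields the two inequalities.

universe u

/-! ### Coloured dimension: finite unions and transfer -/

/-- A set `T` in a metric space has *coloured dimension* less than `m` if, for some constant `c`, it
can be covered at every scale `s > 0` by `m` sets, each partitioned (by the values of a labelling)
into classes of diameter at most `c * s` any two of which are more than `s` apart. -/
def ColorBound {α : Type u} [MetricSpace α] (m : ℕ) (T : Set α) : Prop :=
  ∃ c : ℝ, 0 < c ∧ ∀ s : ℝ, 0 < s → ∃ (ι : Type u) (C : Fin m → Set α) (l : Fin m → α → ι),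
    T ⊆ ⋃ k, C k ∧ ∀ k, ∀ x ∈ C k, ∀ y ∈ C k,
      (l k x = l k y → dist x y ≤ c * s) ∧ (dist x y ≤ s → l k x = l k y)

namespace ColorBound

variable {α : Type u} [MetricSpace α] {m : ℕ} {S T : Set α}

theorem mono (hT : ColorBound m T) (h : S ⊆ T) : ColorBound m S := by
  obtain ⟨c, hc, H⟩ := hT
  refine ⟨c, hc, fun s hs => ?_⟩
  obtain ⟨ι, C, l, hC, hl⟩ := H s hs
  exact ⟨ι, C, l, h.trans hC, hl⟩

theorem empty (m : ℕ) : ColorBound m (∅ : Set α) :=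
  ⟨1, one_pos, fun _ _ => ⟨PUnit, fun _ => ∅, fun _ _ => PUnit.unit, by simp, by simp⟩⟩

theorem singleton (m : ℕ) (a : α) : ColorBound (m + 1) ({a} : Set α) := by
  refine ⟨1, one_pos, fun s hs => ⟨PUnit, fun _ => {a}, fun _ _ => PUnit.unit, ?_, ?_⟩⟩
  · exact fun x hx => Set.mem_iUnion.2 ⟨0, hx⟩
  · rintro k x rfl y rfl
    simp [hs.le]

theorem eq_empty (h : ColorBound 0 T) : T = ∅ := by
  obtain ⟨c, -, H⟩ := h
  obtain ⟨ι, C, l, hC, -⟩ := H 1 one_pos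
  simpa using hC

/-- A class of `A` coming within `s` of `B` is absorbed into a class of `B`. Two points of `B` near
the same class of `A` are at most `s + a * s + s` apart; labelling `B` at scale `(a + 2) * s`
therefore makes the absorption unambiguous. Classes of `A` far from `B` keep their labels. -/
theorem exists_merged_label {A B : Set α} {ι : Type u} {ι' : Type u} {a b s : ℝ}
    (ha : 0 < a) (hb : 0 < b) (hs : 0 < s) (l : α → ι) (l' : α → ι')
    (hA : ∀ x ∈ A, ∀ y ∈ A, (l x = l y → dist x y ≤ a * s) ∧ (dist x y ≤ s → l x = l y))
    (hB : ∀ x ∈ B, ∀ y ∈ B, (l' x = l' y → dist x y ≤ b * ((a + 2) * s)) ∧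
      (dist x y ≤ (a + 2) * s → l' x = l' y)) :
    ∃ lab : α → ι' ⊕ ι, ∀ x ∈ A ∪ B, ∀ y ∈ A ∪ B,
      (lab x = lab y → dist x y ≤ (2 * (a + 1) + b * (a + 2)) * s) ∧
      (dist x y ≤ s → lab x = lab y) := by
  classical
  let P : α → α → Prop := fun x y =>
    y ∈ B ∧ (x = y ∨ x ∈ A ∧ ∃ x' ∈ A, l x' = l x ∧ dist x' y ≤ s)
  have has : 0 < a * s := mul_pos ha hs
  have hPd : ∀ x y, P x y → dist x y ≤ (a + 1) * s := by
    rintro x y ⟨-, rfl | ⟨hx, x', hx', h1, h2⟩⟩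
    · rw [dist_self]; positivity
    · have := (hA x hx x' hx').1 h1.symm
      linarith [dist_triangle x x' y]
  have hPu : ∀ x y y', P x y → P x y' → l' y = l' y' := by
    intro x y y' h h'
    refine (hB y h.1 y' h'.1).2 ?_
    have hd := hPd x y h
    have hd' := hPd x y' h'
    obtain ⟨-, rfl | ⟨-, x₁, hx₁, h1, h2⟩⟩ := h
    · linarith
    obtain ⟨-, rfl | ⟨-, x₂, hx₂, h3, h4⟩⟩ := h'
    · rw [dist_comm]; linarith
    have := (hA x₁ hx₁ x₂ hx₂).1 (h1.trans h3.symm)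
    have h5 := dist_triangle y x₁ x₂
    have h6 := dist_triangle y x₂ y'
    rw [dist_comm y x₁] at h5
    linarith
  let lab : α → ι' ⊕ ι := fun x =>
    if h : ∃ y, P x y then Sum.inl (l' h.choose) else Sum.inr (l x)
  have hlab : ∀ x y, P x y → lab x = Sum.inl (l' y) := by
    intro x y h
    have hex : ∃ y, P x y := ⟨y, h⟩
    simp only [lab, dif_pos hex]
    rw [hPu x _ _ hex.choose_spec h]
  have hlab' : ∀ x, (¬ ∃ y, P x y) → lab x = Sum.inr (l x) := fun x h => by
    simp only [lab, dif_neg h]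
  have hself : ∀ x ∈ B, P x x := fun x hx => ⟨hx, Or.inl rfl⟩
  have hAof : ∀ x ∈ A ∪ B, (¬ ∃ y, P x y) → x ∈ A := by
    rintro x (hx | hx) h
    · exact hx
    · exact (h ⟨x, hself x hx⟩).elim
  have key : ∀ x ∈ B, ∀ y ∈ A ∪ B, dist x y ≤ s → lab x = lab y := by
    rintro x hx y hy hxy
    rw [hlab x x (hself x hx)]
    rcases hy with hy | hy
    · rw [hlab y x ⟨hx, Or.inr ⟨hy, y, hy, rfl, by rwa [dist_comm]⟩⟩]
    · rw [hlab y y (hself y hy), (hB x hx y hy).2 (by linarith)]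
  refine ⟨lab, fun x hx y hy => ⟨fun h => ?_, fun h => ?_⟩⟩
  · by_cases hPx : ∃ z, P x z <;> by_cases hPy : ∃ z, P y z
    · obtain ⟨z, hz⟩ := hPx
      obtain ⟨w, hw⟩ := hPy
      rw [hlab x z hz, hlab y w hw] at h
      have h1 := (hB z hz.1 w hw.1).1 (Sum.inl.inj h)
      have h2 := hPd x z hz
      have h3 := hPd y w hw
      have h4 := dist_triangle x z y
      have h5 := dist_triangle z w y
      rw [dist_comm w y] at h5
      linarith
    · obtain ⟨z, hz⟩ := hPx
      rw [hlab x z hz, hlab' y hPy] at h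
      cases h
    · obtain ⟨z, hz⟩ := hPy
      rw [hlab y z hz, hlab' x hPx] at h
      cases h
    · rw [hlab' x hPx, hlab' y hPy] at h
      have := (hA x (hAof x hx hPx) y (hAof y hy hPy)).1 (Sum.inr.inj h)
      have h2 : 0 ≤ b * (a + 2) * s := by positivity
      linarith
  · by_cases hxB : x ∈ B
    · exact key x hxB y hy h
    by_cases hyB : y ∈ B
    · exact (key y hyB x hx (by rwa [dist_comm])).symm
    have hxA : x ∈ A := hx.resolve_right hxB
    have hyA : y ∈ A := hy.resolve_right hyB
    have hl := (hA x hxA y hyA).2 h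
    have tr : ∀ x ∈ A, ∀ y ∈ A, x ∉ B → l x = l y → ∀ z, P x z → P y z := by
      rintro x hx y hy hxB hl z ⟨hz, rfl | ⟨-, x', hx', h1, h2⟩⟩
      · exact (hxB hz).elim
      · exact ⟨hz, Or.inr ⟨hy, x', hx', h1.trans hl, h2⟩⟩
    by_cases hPx : ∃ z, P x z
    · obtain ⟨z, hz⟩ := hPx
      rw [hlab x z hz, hlab y z (tr x hxA y hyA hxB hl z hz)]
    · have hPy : ¬ ∃ z, P y z := fun ⟨z, hz⟩ => hPx ⟨z, tr y hyA x hxA hyB hl.symm z hz⟩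
      rw [hlab' x hPx, hlab' y hPy, hl]

theorem union (hS : ColorBound m S) (hT : ColorBound m T) : ColorBound m (S ∪ T) := by
  obtain ⟨a, ha, HS⟩ := hS
  obtain ⟨b, hb, HT⟩ := hT
  refine ⟨2 * (a + 1) + b * (a + 2), by positivity, fun s hs => ?_⟩
  obtain ⟨ι, A, l, hA, hl⟩ := HS s hs
  obtain ⟨ι', B, l', hB, hl'⟩ := HT ((a + 2) * s) (by positivity)
  choose lab hlab using fun k => exists_merged_label ha hb hs (l k) (l' k) (hl k) (hl' k)
  refine ⟨ι' ⊕ ι, fun k => A k ∪ B k, lab, ?_, hlab⟩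
  rw [Set.iUnion_union_distrib]
  exact Set.union_subset_union hA hB

theorem iUnion {κ : Type*} [Finite κ] {T : κ → Set α} (h : ∀ i, ColorBound m (T i)) :
    ColorBound m (⋃ i, T i) := by
  have : ∀ s : Set κ, s.Finite → ColorBound m (⋃ i ∈ s, T i) := by
    intro s hs
    induction s, hs using Set.Finite.induction_on with
    | empty => simpa using ColorBound.empty m
    | @insert a s _ _ ih =>
      rw [Set.biUnion_insert]
      exact (h a).union ih
  simpa using this Set.univ Set.finite_univ

theorem of_finite (hT : T.Finite) : ColorBound (m + 1) T := by
  have := hT.to_subtype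
  have h := ColorBound.iUnion (T := fun i : T => ({(i : α)} : Set α))
    (fun i => ColorBound.singleton m (i : α))
  simpa using h

/-- Transfer of `ColorBound` along a map that is, up to scaling factors, uniformly bilipschitz on
pieces accumulating only at one point relative to which they are uniformly separated. -/
theorem transfer {β : Type u} [MetricSpace β] {κ : Type u} {T : Set β}
    (hS : ColorBound (m + 1) S) (h : β → α) (hmaps : Set.MapsTo h T S) (idx : β → κ)
    (scale : κ → ℝ) (y₀ : β) {K : ℝ} (hK : 0 < K)
    (hlow : ∀ x ∈ T, ∀ y ∈ T, idx x = idx y → scale (idx x) * dist x y ≤ dist (h x) (h y))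
    (hup : ∀ x ∈ T, ∀ y ∈ T, idx x = idx y → dist (h x) (h y) ≤ K * scale (idx x) * dist x y)
    (hpos : ∀ x ∈ T, 0 < scale (idx x))
    (hcomp : ∀ x ∈ T, ∀ y ∈ T, idx x = idx y → dist x y₀ ≤ K * dist y y₀)
    (hsep : ∀ x ∈ T, ∀ y ∈ T, idx x ≠ idx y → dist x y₀ ≤ K * dist x y) :
    ColorBound (m + 1) T := by
  classical
  obtain ⟨c, hc, H⟩ := hS
  -- `c * K` bounds the classes inside far pieces, `2 * K * K` the single class around `y₀`.
  refine ⟨c * K + 2 * K * K, by positivity, fun s hs => ?_⟩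
  have H' : ∀ i : κ, ∃ (ι : Type u) (C : Fin (m + 1) → Set α) (l : Fin (m + 1) → α → ι),
      0 < scale i → S ⊆ ⋃ k, C k ∧ ∀ k, ∀ x ∈ C k, ∀ y ∈ C k,
      (l k x = l k y → dist x y ≤ c * (K * scale i * s)) ∧
        (dist x y ≤ K * scale i * s → l k x = l k y) := by
    intro i
    by_cases hi : 0 < scale i
    · obtain ⟨ι, C, l, h1, h2⟩ := H (K * scale i * s) (by positivity)
      exact ⟨ι, C, l, fun _ => ⟨h1, h2⟩⟩
    · exact ⟨PUnit, fun _ => ∅, fun _ _ => PUnit.unit, fun h => (hi h).elim⟩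
  choose ι C l hCl using H'
  -- A piece reaching within `K * s` of `y₀` lies entirely within `K * K * s` of it; all such pieces
  -- share the label `none`. Every other piece is more than `s` away from the rest of `T`, so it can
  -- be coloured on its own.
  let small : κ → Prop := fun i => ∃ x ∈ T, idx x = i ∧ dist x y₀ ≤ K * s
  have hsmall : ∀ x ∈ T, small (idx x) → dist x y₀ ≤ K * K * s := by
    rintro x hx ⟨y, hy, hxy, hd⟩
    have := hcomp x hx y hy hxy.symm
    nlinarith
  have hbig : ∀ x ∈ T, ¬ small (idx x) → K * s < dist x y₀ := by
    intro x hx hn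
    by_contra hle
    exact hn ⟨x, hx, rfl, not_lt.1 hle⟩
  have hnear : ∀ x ∈ T, ∀ y ∈ T, ¬ small (idx x) → dist x y ≤ s → idx x = idx y := by
    intro x hx y hy hn hd
    by_contra hne
    have := hsep x hx y hy hne
    have := hbig x hx hn
    nlinarith
  refine ⟨Option (Σ i : κ, ι i),
    fun k => {x | x ∈ T ∧ (small (idx x) ∨ h x ∈ C (idx x) k)},
    fun k x => if small (idx x) then none else some ⟨idx x, l (idx x) k (h x)⟩, ?_, ?_⟩
  · intro x hx
    obtain ⟨k, hk⟩ := Set.mem_iUnion.1 ((hCl (idx x) (hpos x hx)).1 (hmaps hx))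
    exact Set.mem_iUnion.2 ⟨k, hx, Or.inr hk⟩
  · rintro k x ⟨hx, hxk⟩ y ⟨hy, hyk⟩
    by_cases hsx : small (idx x) <;> by_cases hsy : small (idx y)
    · simp only [if_pos hsx, if_pos hsy, true_imp_iff, implies_true, and_true]
      have h1 := hsmall x hx hsx
      have h2 := hsmall y hy hsy
      have h3 := dist_triangle x y₀ y
      rw [dist_comm y₀ y] at h3
      have : 0 ≤ c * K * s := by positivity
      linarith
    · simp only [if_pos hsx, if_neg hsy, reduceCtorEq, false_imp_iff, true_and, imp_false, not_le]
      by_contra hle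
      have := hnear y hy x hx hsy (by rw [dist_comm]; exact not_lt.1 hle)
      exact hsy (this ▸ hsx)
    · simp only [if_neg hsx, if_pos hsy, reduceCtorEq, false_imp_iff, true_and, imp_false, not_le]
      by_contra hle
      have := hnear x hx y hy hsx (not_lt.1 hle)
      exact hsx (this ▸ hsy)
    · simp only [if_neg hsx, if_neg hsy, Option.some.injEq]
      have hxC := hxk.resolve_left hsx
      have hyC := hyk.resolve_left hsy
      have hp := hpos x hx
      refine ⟨fun he => ?_, fun hd => ?_⟩
      · have hi : idx x = idx y := congrArg Sigma.fst he
        have he' : l (idx x) k (h x) = l (idx x) k (h y) := by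
          rw [← hi] at he
          exact eq_of_heq (Sigma.mk.inj he).2
        have h1 := (((hCl (idx x) hp).2 k (h x) hxC (h y) (hi ▸ hyC))).1 he'
        have h2 := hlow x hx y hy hi
        have h3 : dist x y ≤ c * K * s := by
          refine le_of_mul_le_mul_left ?_ hp
          linarith
        have : 0 ≤ 2 * K * K * s := by positivity
        linarith
      · have hi : idx x = idx y := hnear x hx y hy hsx hd
        have he' : l (idx x) k (h x) = l (idx x) k (h y) := by
          refine (((hCl (idx x) hp).2 k (h x) hxC (h y) (hi ▸ hyC))).2 ?_
          exact (hup x hx y hy hi).trans (mul_le_mul_of_nonneg_left hd (by positivity))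
        rw [he', ← hi]

end ColorBound

/-! ### Nagata bounds as colour bounds -/

theorem sMultiplicity_le_iff {X : Type*} [MetricSpace X] {s : ℝ} {𝓑 : Set (Set X)} {m : ℕ} :
    sMultiplicity s 𝓑 ≤ (m : ℕ∞) ↔ ∀ A : Set X, Metric.ediam A ≤ ENNReal.ofReal s →
      {B ∈ 𝓑 | (B ∩ A).Nonempty}.encard ≤ (m : ℕ∞) := by
  refine ⟨fun h => ?_, fun h => iInf₂_le m h⟩
  by_contra hcon
  have : ((m + 1 : ℕ) : ℕ∞) ≤ sMultiplicity s 𝓑 := by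
    refine le_iInf₂ fun k hk => ?_
    by_contra hlt
    have hkm : k ≤ m := by
      have : k < m + 1 := by exact_mod_cast not_le.1 hlt
      omega
    exact hcon fun A hA => (hk A hA).trans (by exact_mod_cast hkm)
  have h' : ((m + 1 : ℕ) : ℕ∞) ≤ (m : ℕ∞) := this.trans h
  have : m + 1 ≤ m := by exact_mod_cast h'
  omega

theorem ediam_le_ofReal_iff {X : Type*} [MetricSpace X] {A : Set X} {s : ℝ} (hs : 0 ≤ s) :
    Metric.ediam A ≤ ENNReal.ofReal s ↔ ∀ x ∈ A, ∀ y ∈ A, dist x y ≤ s := by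
  rw [Metric.ediam_le_iff]
  simp only [edist_dist, ENNReal.ofReal_le_ofReal_iff hs]

/-- A nonempty finite family of reals containing `0` with at most `m` members leaves a gap
`(i * g, (i + 1) * g)` with `i < m`. -/
theorem exists_gap {β : Type*} {F : Set β} {D : β → ℝ} {m : ℕ} {g : ℝ} (hg : 0 < g)
    (hF : F.encard ≤ (m : ℕ∞)) {b₀ : β} (hb₀ : b₀ ∈ F) (hD₀ : D b₀ = 0) :
    ∃ i : ℕ, i < m ∧ ∀ b ∈ F, i * g < D b → (i + 1) * g ≤ D b := by
  by_contra! hcon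
  -- Pigeonhole: if no gap were free, the ceilings of `D b / g` would take all the values `0, …, m`,
  -- with `0` supplied by `b₀`.
  have hsub : ((Finset.range (m + 1) : Finset ℕ) : Set ℕ) ⊆ (fun b => ⌈D b / g⌉₊) '' F := by
    intro j hj
    rcases j with _ | i
    · exact ⟨b₀, hb₀, by simp [hD₀]⟩
    · obtain ⟨b, hb, h1, h2⟩ := hcon i (by simpa using hj)
      refine ⟨b, hb, ?_⟩
      simp only
      rw [Nat.ceil_eq_iff (by omega)]
      push_cast
      rw [lt_div_iff₀ hg, div_le_iff₀ hg]
      exact ⟨by simpa using h1, h2.le⟩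
  have h1 := (Set.encard_le_encard hsub).trans ((Set.encard_image_le _ F).trans hF)
  rw [Set.encard_coe_eq_coe_finsetCard, Finset.card_range] at h1
  have : m + 1 ≤ m := by exact_mod_cast h1
  omega

/-- From a covering of small multiplicity at scale `4 * (m + 1) * s` to `m` coloured families. -/
theorem exists_colouring {X : Type u} [MetricSpace X] {m : ℕ} {c s : ℝ} (hc : 0 < c) (hs : 0 < s)
    {𝓑 : Set (Set X)} (hcov : ⋃₀ 𝓑 = Set.univ)
    (hbd : IsBoundedFamily (c * (4 * (m + 1) * s)) 𝓑)
    (hmul : sMultiplicity (4 * (m + 1) * s) 𝓑 ≤ (m : ℕ∞)) :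
    ∃ (C : Fin m → Set X) (l : Fin m → X → Set (Set X)),
      Set.univ ⊆ ⋃ k, C k ∧ ∀ k, ∀ x ∈ C k, ∀ y ∈ C k,
      (l k x = l k y → dist x y ≤ (c + 1) * (4 * (m + 1)) * s) ∧
        (dist x y ≤ s → l k x = l k y) := by
  classical
  rw [sMultiplicity_le_iff] at hmul
  -- Room for `m` gaps of length `2 * s`, while a ball of radius `M` still has diameter at most `4 *
  -- (m + 1) * s` and so meets at most `m` members.
  set M : ℝ := m * (2 * s) with hM
  have hM0 : 0 ≤ M := by positivity
  let 𝓝 : Set (Set X) := {B ∈ 𝓑 | B.Nonempty}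
  -- A cluster of members near `x`, closer than all other members by a margin `2 * s`. Its
  -- cardinality serves as the colour of `x` and the cluster itself as the label.
  let Gap : Set (Set X) → X → Prop := fun σ x => σ ⊆ 𝓝 ∧ (∀ B ∈ σ, Metric.infDist x B < M) ∧
    ∀ B ∈ σ, ∀ B' ∈ 𝓝, B' ∉ σ → Metric.infDist x B + 2 * s ≤ Metric.infDist x B'
  have hex : ∀ (k : Fin m) (x : X), ∃ σ : Set (Set X),
      (∃ σ : Set (Set X), σ.encard = ((k + 1 : ℕ) : ℕ∞) ∧ Gap σ x) →
      σ.encard = ((k + 1 : ℕ) : ℕ∞) ∧ Gap σ x := by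
    intro k x
    by_cases h : ∃ σ : Set (Set X), σ.encard = ((k + 1 : ℕ) : ℕ∞) ∧ Gap σ x
    · exact ⟨h.choose, fun _ => h.choose_spec⟩
    · exact ⟨∅, fun h' => (h h').elim⟩
  choose l hl using hex
  refine ⟨fun k => {x | ∃ σ : Set (Set X), σ.encard = ((k + 1 : ℕ) : ℕ∞) ∧ Gap σ x}, l, ?_, ?_⟩
  · intro x _
    let F : Set (Set X) := {B ∈ 𝓑 | (B ∩ Metric.closedBall x M).Nonempty}
    have hF : F.encard ≤ (m : ℕ∞) := by
      refine hmul _ ((ediam_le_ofReal_iff (by positivity)).2 fun y hy z hz => ?_)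
      rw [Metric.mem_closedBall] at hy hz
      have := dist_triangle_right y z x
      have : 0 ≤ 4 * s := by positivity
      rw [hM] at hy hz
      linarith
    obtain ⟨B₀, hB₀, hx₀⟩ : x ∈ ⋃₀ 𝓑 := hcov ▸ Set.mem_univ x
    have hB₀F : B₀ ∈ F := ⟨hB₀, x, hx₀, Metric.mem_closedBall_self hM0⟩
    have hinN : ∀ B ∈ 𝓝, Metric.infDist x B < M → B ∈ F := by
      rintro B ⟨hB, hBn⟩ h
      obtain ⟨b, hb, hd⟩ := (Metric.infDist_lt_iff hBn).1 h
      exact ⟨hB, b, hb, by rw [Metric.mem_closedBall, dist_comm]; exact hd.le⟩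
    obtain ⟨i, him, hi⟩ := exists_gap (D := fun B => Metric.infDist x B) (g := 2 * s)
      (by positivity) hF hB₀F (Metric.infDist_zero_of_mem hx₀)
    have him' : ((i : ℝ) + 1) * (2 * s) ≤ M :=
      mul_le_mul_of_nonneg_right (by exact_mod_cast him) (by positivity)
    let σ : Set (Set X) := {B ∈ 𝓝 | Metric.infDist x B ≤ i * (2 * s)}
    have hσF : σ ⊆ F := fun B hB => hinN B hB.1 (by have := hB.2; linarith)
    have hσcard : σ.encard ≤ (m : ℕ∞) := (Set.encard_le_encard hσF).trans hF
    have hσfin : σ.Finite := Set.finite_of_encard_le_coe hσcard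
    have hσne : σ.Nonempty :=
      ⟨B₀, ⟨hB₀, x, hx₀⟩, by rw [Metric.infDist_zero_of_mem hx₀]; positivity⟩
    have hpos : 0 < σ.ncard := (Set.ncard_pos hσfin).2 hσne
    rw [← hσfin.cast_ncard_eq] at hσcard
    have hle : σ.ncard ≤ m := by exact_mod_cast hσcard
    refine Set.mem_iUnion.2 ⟨⟨σ.ncard - 1, by omega⟩, σ, ?_, fun B hB => hB.1, ?_, ?_⟩
    · rw [← hσfin.cast_ncard_eq, Nat.sub_add_cancel hpos]
    · intro B hB
      have := hB.2
      linarith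
    · intro B hB B' hB' hn
      have h1 : i * (2 * s) < Metric.infDist x B' := by
        by_contra hle
        exact hn ⟨hB', not_lt.1 hle⟩
      have h2 := hB.2
      by_cases hBM : Metric.infDist x B' < M
      · have := hi B' (hinN B' hB' hBM) h1
        linarith
      · linarith
  · intro k x hx y hy
    obtain ⟨hcx, hsx, hmx, hgx⟩ := hl k x hx
    obtain ⟨hcy, hsy, hmy, hgy⟩ := hl k y hy
    refine ⟨fun he => ?_, fun hd => ?_⟩
    · obtain ⟨B, hB⟩ : (l k x).Nonempty := by
        rw [← Set.encard_ne_zero, hcx]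
        exact_mod_cast Nat.succ_ne_zero (k : ℕ)
      obtain ⟨b, hb, hxb⟩ := (Metric.infDist_lt_iff (hsx hB).2).1 (hmx B hB)
      obtain ⟨b', hb', hyb⟩ := (Metric.infDist_lt_iff (hsx hB).2).1 (hmy B (he ▸ hB))
      have h1 := (ediam_le_ofReal_iff (by positivity)).1 (hbd B (hsx hB).1) b hb b' hb'
      have h2 := dist_triangle4_right x y b b'
      have : 0 ≤ 4 * s := by positivity
      rw [hM] at hxb hyb
      linarith
    · by_contra hne
      have hfx : (l k x).Finite := Set.finite_of_encard_eq_coe hcx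
      have hfy : (l k y).Finite := Set.finite_of_encard_eq_coe hcy
      have h1 : ¬ l k x ⊆ l k y := fun h =>
        hne (hfx.eq_of_subset_of_encard_le h (by rw [hcx, hcy]))
      have h2 : ¬ l k y ⊆ l k x := fun h =>
        hne (hfy.eq_of_subset_of_encard_le h (by rw [hcx, hcy])).symm
      -- Distinct clusters of equal size each have a member missing from the other. The two margins
      -- add up to `4 * s`, but moving from `x` to `y` changes the two distances by at most `2 * s`
      -- in total.
      obtain ⟨B, hBx, hBy⟩ := Set.not_subset.1 h1
      obtain ⟨B', hBy', hBx'⟩ := Set.not_subset.1 h2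
      have h3 := hgx B hBx B' (hsy hBy') hBx'
      have h4 := hgy B' hBy' B (hsx hBx) hBy
      have h5 := Metric.infDist_le_infDist_add_dist (s := B') (x := x) (y := y)
      have h6 := Metric.infDist_le_infDist_add_dist (s := B) (x := y) (y := x)
      rw [dist_comm y x] at h6
      linarith

/-- Backwards, the classes form the covering: a set of diameter at most `s` meets at most one class
of each colour. Forwards is `exists_colouring`, at the cost of a larger constant. -/
theorem hasNagataBound_iff_colorBound {α : Type u} [MetricSpace α] {T : Set α} {n : ℤ} :
    HasNagataBound T n ↔ 0 ≤ n + 1 ∧ ColorBound (n + 1).toNat T := by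
  classical
  constructor
  · rintro ⟨c, hc, H⟩
    have hn : 0 ≤ n + 1 := by
      obtain ⟨𝓑, -, -, k, hk, -⟩ := H 1 one_pos
      omega
    refine ⟨hn, (c + 1) * (4 * ((n + 1).toNat + 1)), by positivity, fun s hs => ?_⟩
    obtain ⟨𝓑, hcov, hbd, k, hk, hmul⟩ := H (4 * ((n + 1).toNat + 1) * s) (by positivity)
    have hk' : k ≤ (n + 1).toNat := by omega
    obtain ⟨C, l, hC, hl⟩ := exists_colouring hc hs hcov hbd
      (hmul.trans (by exact_mod_cast hk'))
    refine ⟨Option (Set (Set T)), fun k => Subtype.val '' C k,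
      fun k => Function.extend Subtype.val (fun x => some (l k x)) (fun _ => none), ?_, ?_⟩
    · intro x hx
      obtain ⟨k, hk⟩ := Set.mem_iUnion.1 (hC (Set.mem_univ (⟨x, hx⟩ : T)))
      exact Set.mem_iUnion.2 ⟨k, _, hk, rfl⟩
    · rintro k _ ⟨x, hx, rfl⟩ _ ⟨y, hy, rfl⟩
      beta_reduce
      rw [Subtype.val_injective.extend_apply, Subtype.val_injective.extend_apply,
        Option.some.injEq]
      exact hl k x hx y hy
  · rintro ⟨hn, c, hc, H⟩
    refine ⟨c, hc, fun s hs => ?_⟩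
    obtain ⟨ι, C, l, hC, hl⟩ := H s hs
    let piece : Fin (n + 1).toNat → ι → Set T := fun k i => {x | (x : α) ∈ C k ∧ l k x = i}
    refine ⟨{B | ∃ k i, B = piece k i}, ?_, ?_, (n + 1).toNat, by omega, ?_⟩
    · refine Set.eq_univ_of_forall fun x => ?_
      obtain ⟨k, hk⟩ := Set.mem_iUnion.1 (hC x.2)
      exact ⟨piece k (l k x), ⟨k, _, rfl⟩, hk, rfl⟩
    · rintro _ ⟨k, i, rfl⟩
      refine (ediam_le_ofReal_iff (by positivity)).2 ?_
      rintro x ⟨hx, hxi⟩ y ⟨hy, hyi⟩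
      exact (hl k x hx y hy).1 (hxi.trans hyi.symm)
    · rw [sMultiplicity_le_iff]
      intro A hA
      rw [ediam_le_ofReal_iff hs.le] at hA
      have hsub : {B | B ∈ {B | ∃ k i, B = piece k i} ∧ (B ∩ A).Nonempty} ⊆
          (fun k => {x : T | (x : α) ∈ C k ∧ ∃ y ∈ A, (y : α) ∈ C k ∧ l k x = l k y}) ''
            Set.univ := by
        rintro _ ⟨⟨k, i, rfl⟩, y, ⟨hy, rfl⟩, hyA⟩
        refine ⟨k, Set.mem_univ k, ?_⟩
        ext x
        refine and_congr_right fun hx => ⟨?_, fun h => ⟨y, hyA, hy, h⟩⟩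
        rintro ⟨z, hzA, hz, hxz⟩
        exact hxz.trans ((hl k z hz y hy).2 (hA z hzA y hyA))
      refine (Set.encard_le_encard hsub).trans ((Set.encard_image_le _ _).trans ?_)
      simp [Set.encard_univ]

theorem ndim_eq_of_colorBound_iff {α β : Type u} [MetricSpace α] [MetricSpace β] {S : Set α}
    {T : Set β} (h : ∀ m, ColorBound m S ↔ ColorBound m T) : ndim S = ndim T := by
  unfold ndim
  simp only [hasNagataBound_iff_colorBound, h]

/-! ### Distortion of complex polynomials -/

theorem Multiset.exists_norm_prod_sub_le (s : Multiset ℂ) {η : ℝ} (hη : 0 < η) :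
    ∃ ε : ℝ, 0 < ε ∧ ∀ z w : ℂ, ∀ R : ℝ, (∀ c ∈ s, R ≤ ‖z - c‖) → ‖w - z‖ ≤ ε * R →
      ‖(s.map fun c => w - c).prod - (s.map fun c => z - c).prod‖ ≤
        η * ‖(s.map fun c => z - c).prod‖ := by
  induction s using Multiset.induction_on generalizing η with
  | empty => exact ⟨1, one_pos, fun z w R _ _ => by simp [hη.le]⟩
  | cons c s ih =>
    -- The bound `1` gives `‖B‖ ≤ 2 * ‖A‖`, so the total relative error is at most `η / 4 * 2 + η /
    -- 2`.
    obtain ⟨ε, hε, H⟩ := ih (η := min (η / 2) 1) (by positivity)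
    refine ⟨min ε (η / 4), by positivity, fun z w R hR hw => ?_⟩
    have hR0 : 0 ≤ R := by
      have : 0 ≤ min ε (η / 4) * R := (norm_nonneg _).trans hw
      exact nonneg_of_mul_nonneg_right this (by positivity)
    have h1 := H z w R (fun c hc => hR c (Multiset.mem_cons_of_mem hc))
      (hw.trans (mul_le_mul_of_nonneg_right (min_le_left _ _) hR0))
    have h2 : ‖w - z‖ ≤ η / 4 * ‖z - c‖ :=
      (hw.trans (mul_le_mul_of_nonneg_right (min_le_right _ _) hR0)).trans
        (mul_le_mul_of_nonneg_left (hR c (Multiset.mem_cons_self c s)) (by positivity))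
    simp only [Multiset.map_cons, Multiset.prod_cons]
    set A := (s.map fun c => z - c).prod
    set B := (s.map fun c => w - c).prod
    have h3 : ‖B - A‖ ≤ η / 2 * ‖A‖ :=
      h1.trans (mul_le_mul_of_nonneg_right (min_le_left _ _) (norm_nonneg _))
    have h4 : ‖B‖ ≤ 2 * ‖A‖ := by
      have : ‖B - A‖ ≤ 1 * ‖A‖ :=
        h1.trans (mul_le_mul_of_nonneg_right (min_le_right _ _) (norm_nonneg _))
      have h5 : ‖B‖ ≤ ‖B - A‖ + ‖A‖ := by simpa using norm_add_le (B - A) A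
      linarith
    calc ‖(w - c) * B - (z - c) * A‖ = ‖(w - z) * B + (z - c) * (B - A)‖ := by ring_nf
      _ ≤ ‖w - z‖ * ‖B‖ + ‖z - c‖ * ‖B - A‖ := by
        rw [← norm_mul, ← norm_mul]; exact norm_add_le _ _
      _ ≤ (η / 4 * ‖z - c‖) * (2 * ‖A‖) + ‖z - c‖ * (η / 2 * ‖A‖) := by gcongr
      _ = η * ‖(z - c) * A‖ := by rw [norm_mul]; ring

theorem Multiset.norm_prod_sub_le_two_pow (s : Multiset ℂ) {z w : ℂ} {R : ℝ}
    (hR : ∀ c ∈ s, R ≤ ‖z - c‖) (hw : ‖w - z‖ ≤ R) :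
    ‖(s.map fun c => w - c).prod‖ ≤ 2 ^ s.card * ‖(s.map fun c => z - c).prod‖ := by
  induction s using Multiset.induction_on with
  | empty => simp
  | cons c s ih =>
    have h1 := ih fun c hc => hR c (Multiset.mem_cons_of_mem hc)
    have h2 := hR c (Multiset.mem_cons_self c s)
    have h3 : ‖w - c‖ ≤ 2 * ‖z - c‖ := by
      have : ‖w - c‖ ≤ ‖w - z‖ + ‖z - c‖ := by simpa using norm_add_le (w - z) (z - c)
      linarith
    simp only [Multiset.map_cons, Multiset.prod_cons, norm_mul, Multiset.card_cons]
    calc _ ≤ (2 * ‖z - c‖) * (2 ^ s.card * ‖(s.map fun c => z - c).prod‖) := by gcongr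
      _ = _ := by ring

namespace Polynomial

/-- A complex polynomial is nearly constant on discs that are small relative to the distance to its
roots. -/
theorem exists_norm_eval_sub_le {q : ℂ[X]} (hq : q ≠ 0) {η : ℝ} (hη : 0 < η) :
    ∃ ε : ℝ, 0 < ε ∧ ∀ z w : ℂ, ∀ R : ℝ, (∀ c, q.eval c = 0 → R ≤ ‖z - c‖) → ‖w - z‖ ≤ ε * R →
      ‖q.eval w - q.eval z‖ ≤ η * ‖q.eval z‖ := by
  obtain ⟨ε, hε, H⟩ := q.roots.exists_norm_prod_sub_le hη
  refine ⟨ε, hε, fun z w R hR hw => ?_⟩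
  have := H z w R (fun c hc => hR c ((mem_roots hq).1 hc)) hw
  rw [(IsAlgClosed.splits q).eval_eq_prod_roots, (IsAlgClosed.splits q).eval_eq_prod_roots,
    ← mul_sub, norm_mul, norm_mul]
  calc _ ≤ ‖q.leadingCoeff‖ * (η * ‖(q.roots.map fun c => z - c).prod‖) := by gcongr
    _ = _ := by ring

theorem exists_norm_eval_le {q : ℂ[X]} (hq : q ≠ 0) :
    ∃ K : ℝ, 1 ≤ K ∧ ∀ z w : ℂ, ∀ R : ℝ, (∀ c, q.eval c = 0 → R ≤ ‖z - c‖) → ‖w - z‖ ≤ R →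
      ‖q.eval w‖ ≤ K * ‖q.eval z‖ := by
  refine ⟨2 ^ q.roots.card, one_le_pow₀ one_le_two, fun z w R hR hw => ?_⟩
  have := q.roots.norm_prod_sub_le_two_pow (fun c hc => hR c ((mem_roots hq).1 hc)) hw
  rw [(IsAlgClosed.splits q).eval_eq_prod_roots, (IsAlgClosed.splits q).eval_eq_prod_roots,
    norm_mul, norm_mul]
  calc _ ≤ ‖q.leadingCoeff‖ * (2 ^ q.roots.card * ‖(q.roots.map fun c => z - c).prod‖) := by gcongr
    _ = _ := by ring

variable {p : ℂ[X]} {V : Set ℂ}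

theorem finite_preimage_eval (hp : p.derivative ≠ 0) (hV : V.Finite) :
    ((fun z => p.eval z) ⁻¹' V).Finite := by
  refine hV.preimage' fun v _ => ?_
  have hne : p - C v ≠ 0 := by
    intro h
    rw [sub_eq_zero.1 h, derivative_C] at hp
    exact hp rfl
  refine (p - C v).rootSet_finite ℂ |>.subset fun z hz => ?_
  rw [mem_rootSet]
  refine ⟨hne, ?_⟩
  have : p.eval z = v := hz
  simp [this]

theorem surjective_eval (hp : p.derivative ≠ 0) : Function.Surjective fun z => p.eval z := by
  intro v
  have hd : (p - C v).degree ≠ 0 := by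
    intro h
    rw [eq_C_of_degree_eq_zero h |> eq_add_of_sub_eq, derivative_add, derivative_C,
      derivative_C, add_zero] at hp
    exact hp rfl
  obtain ⟨z, hz⟩ := IsAlgClosed.exists_root _ hd
  exact ⟨z, by simpa [IsRoot, sub_eq_zero] using hz⟩

/-- Subtracting the linear map with slope `p.derivative.eval z` leaves a function whose derivative
is at most half that slope in norm; the mean value inequality on the convex disc applies. -/
theorem dist_eval_bounds_of_derivative {z : ℂ} {t : ℝ}
    (h : ∀ w ∈ Metric.closedBall z t,
      ‖p.derivative.eval w - p.derivative.eval z‖ ≤ 1 / 2 * ‖p.derivative.eval z‖)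
    {u v : ℂ} (hu : u ∈ Metric.closedBall z t) (hv : v ∈ Metric.closedBall z t) :
    1 / 2 * ‖p.derivative.eval z‖ * dist u v ≤ dist (p.eval u) (p.eval v) ∧
      dist (p.eval u) (p.eval v) ≤ 2 * ‖p.derivative.eval z‖ * dist u v := by
  set a := p.derivative.eval z
  have key := (convex_closedBall z t).norm_image_sub_le_of_norm_hasDerivWithin_le
    (f := fun w => p.eval w - a * w) (f' := fun w => p.derivative.eval w - a) (𝕜 := ℂ)
    (fun w _ => by
      simpa using ((p.hasDerivAt w).fun_sub ((hasDerivAt_id w).const_mul a)).hasDerivWithinAt)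
    h hv hu
  have e : p.eval u - a * u - (p.eval v - a * v) = (p.eval u - p.eval v) - a * (u - v) := by ring
  simp only [e] at key
  rw [dist_eq_norm, dist_eq_norm]
  have h1 := norm_sub_norm_le (p.eval u - p.eval v) (a * (u - v))
  have h2 := norm_sub_norm_le (a * (u - v)) (p.eval u - p.eval v)
  rw [norm_sub_rev (a * (u - v))] at h2
  rw [norm_mul] at h1 h2
  have h3 : 0 ≤ ‖a‖ * ‖u - v‖ := by positivity
  constructor <;> nlinarith

/-- Scale-invariant distortion estimates for a polynomial map off the preimage of a finite set `V`
containing the critical values. -/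
theorem exists_distortion (hp : p.derivative ≠ 0) (hVf : V.Finite) (hVn : V.Nonempty)
    (hV : ∀ c, p.derivative.eval c = 0 → p.eval c ∈ V) :
    ∃ ε κ : ℝ, 0 < ε ∧ ε ≤ 1 / 2 ∧ 0 < κ ∧ ∀ z, p.eval z ∉ V →
      0 < ‖p.derivative.eval z‖ ∧
      (∀ u ∈ Metric.closedBall z (ε * Metric.infDist z ((fun z => p.eval z) ⁻¹' V)),
        ∀ v ∈ Metric.closedBall z (ε * Metric.infDist z ((fun z => p.eval z) ⁻¹' V)),
        1 / 2 * ‖p.derivative.eval z‖ * dist u v ≤ dist (p.eval u) (p.eval v) ∧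
        dist (p.eval u) (p.eval v) ≤ 2 * ‖p.derivative.eval z‖ * dist u v) ∧
      (∀ w, dist w (p.eval z) < κ * Metric.infDist (p.eval z) V →
        ∃ u, p.eval u = w ∧ dist u z ≤ ε / 2 * Metric.infDist z ((fun z => p.eval z) ⁻¹' V)) ∧
      κ * (‖p.derivative.eval z‖ * Metric.infDist z ((fun z => p.eval z) ⁻¹' V)) ≤
        Metric.infDist (p.eval z) V := by
  obtain ⟨ε₀, hε₀, H₀⟩ := exists_norm_eval_sub_le hp (η := 1 / 2) (by norm_num)
  obtain ⟨K, hK, HK⟩ := exists_norm_eval_le hp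
  set P : Set ℂ := (fun z => p.eval z) ⁻¹' V with hP
  have hPf : P.Finite := finite_preimage_eval hp hVf
  have hPn : P.Nonempty := hVn.preimage (surjective_eval hp)
  have hK0 : 0 < K := one_pos.trans_le hK
  set ε : ℝ := min ε₀ (1 / 2) with hε
  have hε0 : 0 < ε := by positivity
  have hε1 : ε ≤ 1 / 2 := min_le_right _ _
  -- The image of the disc of radius `ε / 2 * r` contains a disc of radius `ε * a * r / 8`
  -- (`hball`), while the distance to `V` is at most `K * a * r` (`hupper`).
  refine ⟨ε, ε / (8 * K), hε0, hε1, by positivity, fun z hz => ?_⟩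
  have hzP : z ∉ P := hz
  set r := Metric.infDist z P with hr
  have hr0 : 0 < r := (hPf.isClosed.notMem_iff_infDist_pos hPn).1 hzP
  have ha : 0 < ‖p.derivative.eval z‖ := norm_pos_iff.2 fun h => hz (hV z h)
  set a := ‖p.derivative.eval z‖ with haa
  have hroots : ∀ c, p.derivative.eval c = 0 → r ≤ ‖z - c‖ := fun c hc => by
    rw [← dist_eq_norm]
    exact Metric.infDist_le_dist_of_mem (hV c hc)
  have hbil : ∀ u ∈ Metric.closedBall z (ε * r), ∀ v ∈ Metric.closedBall z (ε * r),
      1 / 2 * a * dist u v ≤ dist (p.eval u) (p.eval v) ∧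
        dist (p.eval u) (p.eval v) ≤ 2 * a * dist u v := by
    intro u hu v hv
    refine dist_eval_bounds_of_derivative (fun w hw => ?_) hu hv
    refine H₀ z w r hroots ?_
    rw [← dist_eq_norm]
    exact (Metric.mem_closedBall.1 hw).trans
      (mul_le_mul_of_nonneg_right (min_le_left _ _) hr0.le)
  have hupper : Metric.infDist (p.eval z) V ≤ K * a * r := by
    obtain ⟨c, hc, hrc⟩ := hPf.isCompact.exists_infDist_eq_dist hPn z
    refine (Metric.infDist_le_dist_of_mem (show p.eval c ∈ V from hc)).trans ?_
    rw [hr, hrc, dist_eq_norm, dist_eq_norm]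
    refine (convex_closedBall z r).norm_image_sub_le_of_norm_hasDerivWithin_le (𝕜 := ℂ)
      (f := fun w => p.eval w) (fun w _ => (p.hasDerivAt w).hasDerivWithinAt)
      (fun w hw => HK z w r hroots (by simpa [dist_eq_norm] using hw)) ?_
      (Metric.mem_closedBall_self hr0.le)
    rw [Metric.mem_closedBall, dist_comm, ← hrc]
  have hball : Metric.ball (p.eval z) (1 / 2 * a * (ε / 2 * r) / 2) ⊆
      (fun w => p.eval w) '' Metric.closedBall z (ε / 2 * r) := by
    have hsub : Metric.closedBall z (ε / 2 * r) ⊆ Metric.closedBall z (ε * r) :=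
      Metric.closedBall_subset_closedBall (by nlinarith)
    have hz' : z ∈ Metric.closedBall z (ε * r) := Metric.mem_closedBall_self (by positivity)
    refine DiffContOnCl.ball_subset_image_closedBall (f := fun w => p.eval w)
      p.differentiable.diffContOnCl (by positivity) (fun w hw => ?_) ?_
    · have h1 := (hbil w (hsub (Metric.sphere_subset_closedBall hw)) z hz').1
      rwa [Metric.mem_sphere.1 hw, dist_eq_norm] at h1
    · exact ((p.hasDerivAt z).eventually_ne (norm_pos_iff.1 ha)).frequently.filter_mono
        nhdsWithin_le_nhds
  refine ⟨ha, hbil, fun w hw => ?_, ?_⟩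
  · obtain ⟨u, hu, hfu⟩ := hball (show w ∈ _ by
      rw [Metric.mem_ball]
      refine hw.trans_le ((mul_le_mul_of_nonneg_left hupper (by positivity)).trans_eq ?_)
      field_simp
      ring)
    exact ⟨u, hfu, hu⟩
  · have h1 : ε / (8 * K) ≤ ε / 8 := by
      apply div_le_div_of_nonneg_left hε0.le (by norm_num)
      linarith
    refine (mul_le_mul_of_nonneg_right h1 (by positivity)).trans ?_
    refine (Metric.le_infDist hVn).2 fun {v} hv => ?_
    -- Otherwise a point of `V` would have a preimage within `ε / 2 * r` of `z`, closer than the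
    -- distance `r` to `P`.
    by_contra hlt
    obtain ⟨u, hu, hfu⟩ := hball (show v ∈ _ by
      rw [Metric.mem_ball, dist_comm]
      linarith)
    have h2 : r ≤ dist z u := Metric.infDist_le_dist_of_mem (show u ∈ P from by
      rw [← hfu] at hv; exact hv)
    rw [Metric.mem_closedBall, dist_comm] at hu
    nlinarith

end Polynomial

/-! ### Whitney-type decomposition off a finite set -/

/-- The index is the floor of the logarithm to base `ρ`: it cuts the radii into annuli of ratio `ρ`,
and skipping an annulus leaves a gap of ratio `ρ`. -/
theorem Real.exists_logarithmic_index {ρ : ℝ} (hρ : 1 < ρ) : ∃ L : ℝ → ℤ, ∀ a b : ℝ, 0 < a → 0 < b →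
    (L a = L b → a < ρ * b) ∧ (L a + 2 ≤ L b → ρ * a < b) := by
  have hl : 0 < Real.log ρ := Real.log_pos hρ
  have hρ0 : 0 < ρ := one_pos.trans hρ
  refine ⟨fun a => ⌊Real.log a / Real.log ρ⌋, fun a b ha hb => ⟨fun h => ?_, fun h => ?_⟩⟩
  · have h1 := Int.lt_floor_add_one (Real.log a / Real.log ρ)
    have h2 := Int.floor_le (Real.log b / Real.log ρ)
    beta_reduce at h
    rw [h] at h1
    have h3 : Real.log a / Real.log ρ < (Real.log b + Real.log ρ) / Real.log ρ := by
      rw [add_div, div_self hl.ne']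
      linarith
    have h4 := (div_lt_div_iff_of_pos_right hl).1 h3
    rw [← Real.log_lt_log_iff ha (by positivity), Real.log_mul hρ0.ne' hb.ne']
    linarith
  · have h1 := Int.lt_floor_add_one (Real.log a / Real.log ρ)
    have h2 := Int.floor_le (Real.log b / Real.log ρ)
    have h' : (⌊Real.log a / Real.log ρ⌋ : ℝ) + 2 ≤ ⌊Real.log b / Real.log ρ⌋ := by exact_mod_cast h
    have h3 : (Real.log a + Real.log ρ) / Real.log ρ < Real.log b / Real.log ρ := by
      rw [add_div, div_self hl.ne']
      linarith
    have h4 := (div_lt_div_iff_of_pos_right hl).1 h3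
    rw [← Real.log_lt_log_iff (by positivity) hb, Real.log_mul hρ0.ne' ha.ne']
    linarith

/-- The complement of a finite set `V` of complex numbers is a union of finitely many sets `W i`,
each partitioned by an integer index into pieces that are small, but well separated, relative to the
distance to `V`. -/
theorem Complex.exists_whitney_colouring {V : Set ℂ} (hVf : V.Finite) (hVn : V.Nonempty) {κ : ℝ}
    (hκ : 0 < κ) :
    ∃ (ι : Type) (_ : Finite ι) (W : ι → Set ℂ) (v : ι → ℂ) (idx : ι → ℂ → ℤ) (K : ℝ), 0 < K ∧
      (∀ w ∉ V, ∃ i, w ∈ W i) ∧ ∀ i, ∀ w ∈ W i, w ∉ V ∧ dist w (v i) = Metric.infDist w V ∧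
        ∀ w' ∈ W i,
          (idx i w = idx i w' → dist w w' < κ * Metric.infDist w V ∧
            dist w (v i) ≤ K * dist w' (v i)) ∧
          (idx i w ≠ idx i w' → dist w (v i) ≤ K * dist w w') := by
  obtain ⟨L, hL⟩ := Real.exists_logarithmic_index (ρ := 1 + κ / 4) (by linarith)
  obtain ⟨t, -, htf, ht⟩ := (isCompact_sphere (0 : ℂ) 1).finite_cover_balls
    (show 0 < κ / 4 by positivity)
  have := hVf.to_subtype
  have := htf.to_subtype
  -- Polar coordinates about a nearest point of `V`: the family records that point, a small cell of
  -- directions and the parity of the annulus; the annulus is the index. Parity forces distinct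
  -- annuli of one family to differ by at least two.
  refine ⟨V × t × Bool, inferInstance, fun i => {w | w ∉ V ∧ dist w i.1 = Metric.infDist w V ∧
    dist ((w - i.1) / (dist w i.1 : ℝ)) i.2.1 < κ / 4 ∧ (Even (L (dist w i.1)) ↔ i.2.2 = true)},
    fun i => i.1, fun i w => L (dist w i.1), 1 + κ / 4 + (1 + κ / 4) / (κ / 4), by positivity,
    fun w hw => ?_, ?_⟩
  · obtain ⟨v, hv, hd⟩ := hVf.isCompact.exists_infDist_eq_dist hVn w
    have hne : w ≠ v := fun h => hw (h ▸ hv)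
    have hpos : 0 < dist w v := dist_pos.2 hne
    have hu : (w - v) / (dist w v : ℝ) ∈ Metric.sphere (0 : ℂ) 1 := by
      rw [mem_sphere_zero_iff_norm, norm_div, Complex.norm_real, Real.norm_of_nonneg hpos.le,
        ← dist_eq_norm, div_self hpos.ne']
    obtain ⟨u, hut, hu'⟩ := Set.mem_iUnion₂.1 (ht hu)
    exact ⟨(⟨v, hv⟩, ⟨u, hut⟩, decide (Even (L (dist w v)))), hw, hd.symm, hu', by simp⟩
  · rintro ⟨⟨v, hv⟩, ⟨u, hu⟩, e⟩ w ⟨hw, hd, hwu, hwe⟩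
    refine ⟨hw, hd, ?_⟩
    rintro w' ⟨hw', hd', hwu', hwe'⟩
    simp only at *
    have ha : 0 < dist w v := dist_pos.2 fun h => hw (h ▸ hv)
    have hb : 0 < dist w' v := dist_pos.2 fun h => hw' (h ▸ hv)
    have hκ' : 0 < (1 + κ / 4) / (κ / 4) := by positivity
    refine ⟨fun h => ?_, fun h => ?_⟩
    · have h1 := (hL _ _ ha hb).1 h
      have h2 := (hL _ _ hb ha).1 h.symm
      refine ⟨?_, h1.le.trans (mul_le_mul_of_nonneg_right (by linarith) hb.le)⟩
      rw [← hd]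
      set a := dist w v
      set b := dist w' v
      set d := (w - v) / (a : ℂ) with hdd
      set d' := (w' - v) / (b : ℂ) with hdd'
      have e1 : w - v = a * d := by
        rw [hdd, mul_div_cancel₀ _ (Complex.ofReal_ne_zero.2 ha.ne')]
      have e2 : w' - v = b * d' := by
        rw [hdd', mul_div_cancel₀ _ (Complex.ofReal_ne_zero.2 hb.ne')]
      have hn : ‖d'‖ = 1 := by
        rw [hdd', norm_div, Complex.norm_real, Real.norm_of_nonneg hb.le, ← dist_eq_norm,
          div_self hb.ne']
      have hdist : ‖d - d'‖ < κ / 2 := by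
        rw [← dist_eq_norm]
        have := dist_triangle_right d d' u
        linarith
      have hab : |a - b| < κ / 4 * a := by
        rw [abs_lt]
        constructor <;> nlinarith
      calc dist w w' = ‖((a - b : ℝ) : ℂ) * d' + a * (d - d')‖ := by
            rw [dist_eq_norm, show w - w' = (w - v) - (w' - v) by ring, e1, e2]
            push_cast
            ring_nf
        _ ≤ |a - b| * 1 + a * ‖d - d'‖ := by
            refine (norm_add_le _ _).trans_eq ?_
            rw [norm_mul, norm_mul, hn, Complex.norm_real, Complex.norm_real,
              Real.norm_of_nonneg ha.le, Real.norm_eq_abs]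
        _ < κ * a := by nlinarith
    · have h1 := dist_triangle w w' v
      have h2 := dist_triangle w' w v
      rw [dist_comm w' w] at h2
      have hpar : Even (L (dist w v)) ↔ Even (L (dist w' v)) := hwe.trans hwe'.symm
      rw [Int.even_iff, Int.even_iff] at hpar
      have hkey : κ / 4 * dist w v ≤ (1 + κ / 4) * dist w w' := by
        rcases lt_or_gt_of_ne h with h | h
        · have := (hL _ _ ha hb).2 (by omega)
          have : 0 ≤ κ / 4 * dist w w' := by positivity
          linarith
        · have h3 := (hL _ _ hb ha).2 (by omega)
          nlinarith
      have h4 : dist w v ≤ (1 + κ / 4) / (κ / 4) * dist w w' := by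
        rw [div_mul_eq_mul_div, le_div_iff₀ (by positivity)]
        linarith
      have : 0 ≤ (1 + κ / 4) * dist w w' := by positivity
      linarith

/-! ### Lifting the decomposition through the polynomial -/

namespace Polynomial

variable {p : ℂ[X]}

theorem exists_enumeration_fibre (hp : p.derivative ≠ 0) (w : ℂ) :
    ∃ e : Fin p.natDegree → ℂ, ∀ z, p.eval z = w → ∃ l, e l = z := by
  refine ⟨fun l => (p - C w).roots.toList.getD l 0, fun z hz => ?_⟩
  have hne : p - C w ≠ 0 := by
    intro h
    rw [sub_eq_zero.1 h, derivative_C] at hp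
    exact hp rfl
  have hz' : z ∈ (p - C w).roots.toList := by
    rw [Multiset.mem_toList, mem_roots hne]
    simp [IsRoot, hz]
  obtain ⟨l, hl, rfl⟩ := List.mem_iff_getElem.1 hz'
  have hlt : l < p.natDegree := by
    rw [Multiset.length_toList] at hl
    exact hl.trans_le ((card_roots' _).trans_eq natDegree_sub_C)
  exact ⟨⟨l, hlt⟩, List.getD_eq_getElem _ _ hl⟩

/-- Off finitely many points, the plane is a union of finitely many sets `U a`, each partitioned by
an integer index into pieces on which the polynomial is uniformly bilipschitz up to scaling. Both
the pieces and their images are well separated relative to the distance to some point. -/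
theorem exists_sheets (hp : p.derivative ≠ 0) :
    ∃ (V : Set ℂ) (ι : Type) (_ : Finite ι) (U : ι → Set ℂ) (v q : ι → ℂ) (J : ι → ℂ → ℤ)
      (scale : ι → ℤ → ℝ) (K : ℝ), V.Finite ∧ 0 < K ∧ (∀ z, p.eval z ∉ V → ∃ a, z ∈ U a) ∧
      ∀ a, ∀ x ∈ U a, 0 < scale a (J a x) ∧ ∀ y ∈ U a,
        (J a x = J a y →
          scale a (J a x) * dist x y ≤ dist (p.eval x) (p.eval y) ∧
          dist (p.eval x) (p.eval y) ≤ K * scale a (J a x) * dist x y ∧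
          dist (p.eval x) (v a) ≤ K * dist (p.eval y) (v a) ∧
          dist x (q a) ≤ K * dist y (q a)) ∧
        (J a x ≠ J a y →
          dist (p.eval x) (v a) ≤ K * dist (p.eval x) (p.eval y) ∧
          dist x (q a) ≤ K * dist x y) := by
  obtain ⟨V, hVf, hVn, hV⟩ : ∃ V : Set ℂ, V.Finite ∧ V.Nonempty ∧
      ∀ c, p.derivative.eval c = 0 → p.eval c ∈ V := by
    -- The point `0` only makes `V` nonempty.
    refine ⟨insert 0 ((fun z => p.eval z) '' (p.derivative.roots.toFinset : Set ℂ)),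
      ((Finset.finite_toSet _).image _).insert 0, Set.insert_nonempty _ _, fun c hc => ?_⟩
    exact Or.inr ⟨c, by simpa [mem_roots hp] using hc, rfl⟩
  obtain ⟨ε, κ, hε, hε1, hκ, H⟩ := exists_distortion hp hVf hVn hV
  obtain ⟨ι, hι, W, v, idx, K₀, hK₀, hcov, hW⟩ := Complex.exists_whitney_colouring hVf hVn hκ
  set P : Set ℂ := (fun z => p.eval z) ⁻¹' V with hP
  have hPf : P.Finite := finite_preimage_eval hp hVf
  have hPn : P.Nonempty := hVn.preimage (surjective_eval hp)
  have := hPf.to_subtype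
  set r : ℂ → ℝ := fun z => Metric.infDist z P with hr
  have hr0 : ∀ z, 0 ≤ r z := fun z => Metric.infDist_nonneg
  have hrd : ∀ x y, r x ≤ r y + dist x y := fun x y => Metric.infDist_le_infDist_add_dist
  choose e he using exists_enumeration_fibre hp
  have hbase : ∀ i j, ∃ w₀, (∃ w ∈ W i, idx i w = j) → w₀ ∈ W i ∧ idx i w₀ = j := by
    intro i j
    by_cases h : ∃ w ∈ W i, idx i w = j
    · exact ⟨h.choose, fun _ => h.choose_spec⟩
    · exact ⟨0, fun h' => (h h').elim⟩
  choose base hbase using hbase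
  -- The `l`-th preimage of the reference point of a Whitney piece; the sheet is cut out by
  -- closeness to it.
  let ctr : ι × Fin p.natDegree × P → ℤ → ℂ := fun a j => e (base a.1 j) a.2.1
  have hKκ : 0 < 2 * K₀ / κ := by positivity
  have hKε : 0 < 1 / ε := by positivity
  refine ⟨V, ι × Fin p.natDegree × P, inferInstance,
    fun a => {x | p.eval x ∈ W a.1 ∧ dist x a.2.2 = r x ∧
      p.eval (ctr a (idx a.1 (p.eval x))) ∉ V ∧
      dist x (ctr a (idx a.1 (p.eval x))) ≤ ε * r (ctr a (idx a.1 (p.eval x)))},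
    fun a => v a.1, fun a => a.2.2, fun a x => idx a.1 (p.eval x),
    fun a j => 1 / 2 * ‖p.derivative.eval (ctr a j)‖, K₀ + 4 + 2 * K₀ / κ + 1 / ε, hVf,
    by positivity, fun x hx => ?_, ?_⟩
  · obtain ⟨i, hi⟩ := hcov _ hx
    obtain ⟨q, hq, hrq⟩ := hPf.isCompact.exists_infDist_eq_dist hPn x
    obtain ⟨hb, hbi⟩ := hbase i _ ⟨_, hi, rfl⟩
    -- The reference point is close enough to `p.eval x` to have a preimage within `ε / 2 * r x` of
    -- `x`. The spare factor two converts this into `ε` times `r` at that preimage.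
    have hnear := (((hW i _ hi).2.2 _ hb).1 hbi.symm).1
    rw [dist_comm] at hnear
    obtain ⟨z, hz, hzx⟩ := (H x hx).2.2.1 _ hnear
    obtain ⟨l, hl⟩ := he _ z hz
    refine ⟨(i, l, ⟨q, hq⟩), hi, hrq.symm, ?_, ?_⟩
    · simp only [ctr, hl, hz]
      exact (hW i _ hb).1
    · simp only [ctr, hl]
      have h1 := hrd x z
      have h2 : dist z x ≤ ε / 2 * r x := hzx
      rw [dist_comm] at h2
      have h3 := hr0 x
      have h4 : r x ≤ 2 * r z := by nlinarith
      nlinarith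
  · rintro ⟨i, l, q, hq⟩ x ⟨hxW, hxq, hxV, hxz⟩
    refine ⟨mul_pos (by norm_num) (H _ hxV).1, ?_⟩
    rintro y ⟨hyW, hyq, hyV, hyz⟩
    simp only at *
    obtain ⟨hxnV, hxv, hxy⟩ := hW i _ hxW
    have hxy := hxy _ hyW
    refine ⟨fun h => ?_, fun h => ?_⟩
    · rw [← h] at hyz hyV
      set z := ctr (i, l, ⟨q, hq⟩) (idx i (p.eval x))
      obtain ⟨h1, h2⟩ := (H z hxV).2.1 x hxz y hyz
      refine ⟨h1, h2.trans ?_, (hxy.1 h).2.trans ?_, ?_⟩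
      · have : 0 ≤ ‖p.derivative.eval z‖ * dist x y := by positivity
        nlinarith
      · exact mul_le_mul_of_nonneg_right (by linarith) dist_nonneg
      · rw [hxq, hyq]
        have h3 := hrd x z
        have h4 := hrd z y
        rw [dist_comm] at h4
        have h5 := hr0 z
        have h6 := hr0 y
        have h7 : r x ≤ 4 * r y := by nlinarith
        exact h7.trans (mul_le_mul_of_nonneg_right (by linarith) h6)
    · have h1 := hxy.2 h
      refine ⟨h1.trans (mul_le_mul_of_nonneg_right (by linarith) dist_nonneg), ?_⟩
      rw [hxq]
      have hle : ∀ A, A ≤ K₀ + 4 + 2 * K₀ / κ + 1 / ε → r x ≤ A * dist x y →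
          r x ≤ (K₀ + 4 + 2 * K₀ / κ + 1 / ε) * dist x y := fun A hA h =>
        h.trans (mul_le_mul_of_nonneg_right hA dist_nonneg)
      -- For close points, the Lipschitz bound turns separation of the images into separation of `x`
      -- and `y`; far points are separated outright.
      by_cases hd : dist x y ≤ ε * r x
      · obtain ⟨ha, hbil, -, hκr⟩ := H x hxnV
        have h2 := (hbil x (Metric.mem_closedBall_self (mul_nonneg hε.le (hr0 x))) y
          (by rwa [Metric.mem_closedBall, dist_comm])).2
        rw [← hxv] at hκr
        refine hle (2 * K₀ / κ) (by linarith) ?_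
        rw [div_mul_eq_mul_div, le_div_iff₀ hκ]
        refine le_of_mul_le_mul_left ?_ ha
        have h3 := mul_le_mul_of_nonneg_left h2 hK₀.le
        have h4 : κ * (‖p.derivative.eval x‖ * r x) ≤
          K₀ * (2 * ‖p.derivative.eval x‖ * dist x y) := (hκr.trans h1).trans h3
        linarith
      · refine hle (1 / ε) (by linarith) ?_
        rw [div_mul_eq_mul_div, one_mul, le_div_iff₀ hε]
        linarith

/-- With at least one colour, the finite exceptional sets are harmless, and `ColorBound.transfer`
applies on each sheet: along the polynomial to bound `X`, along a section with inverted scales to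
bound the image. With no colours both sets are empty. -/
theorem colorBound_image_iff (hp : p.derivative ≠ 0) (X : Set ℂ) (m : ℕ) :
    ColorBound m ((fun z => p.eval z) '' X) ↔ ColorBound m X := by
  rcases m with _ | m
  · constructor <;> intro h <;> have h0 := h.eq_empty
    · rw [Set.image_eq_empty] at h0
      exact h0 ▸ ColorBound.empty 0
    · rw [h0, Set.image_empty]
      exact ColorBound.empty 0
  obtain ⟨V, ι, hι, U, v, q, J, scale, K, hVf, hK, hcov, H⟩ := exists_sheets hp
  constructor <;> intro h
  · refine ((ColorBound.of_finite (m := m) (finite_preimage_eval hp hVf)).union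
      (ColorBound.iUnion (T := fun a => U a ∩ X) fun a => ?_)).mono fun x hx => ?_
    · refine h.transfer (fun z => p.eval z) (fun x hx => ⟨x, hx.2, rfl⟩) (J a) (scale a) (q a) hK
        (fun x hx y hy hxy => ?_) (fun x hx y hy hxy => ?_) (fun x hx => (H a x hx.1).1)
        (fun x hx y hy hxy => ?_) (fun x hx y hy hxy => ?_)
      · exact (((H a x hx.1).2 y hy.1).1 hxy).1
      · exact (((H a x hx.1).2 y hy.1).1 hxy).2.1
      · exact (((H a x hx.1).2 y hy.1).1 hxy).2.2.2
      · exact (((H a x hx.1).2 y hy.1).2 hxy).2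
    · by_cases hxV : p.eval x ∈ V
      · exact Or.inl hxV
      · obtain ⟨a, ha⟩ := hcov x hxV
        exact Or.inr (Set.mem_iUnion.2 ⟨a, ha, hx⟩)
  · refine ((ColorBound.of_finite (m := m) hVf).union
      (ColorBound.iUnion (T := fun a => (fun z => p.eval z) '' (U a ∩ X)) fun a => ?_)).mono ?_
    · let g : ℂ → ℂ := Function.invFunOn (fun z => p.eval z) (U a ∩ X)
      have hg : ∀ w ∈ (fun z => p.eval z) '' (U a ∩ X), g w ∈ U a ∩ X ∧ p.eval (g w) = w :=
        fun w hw => ⟨Function.invFunOn_mem hw, Function.invFunOn_eq hw⟩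
      refine h.transfer g (fun w hw => (hg w hw).1.2) (fun w => J a (g w))
        (fun j => 1 / (K * scale a j)) (v a) hK
        (fun x hx y hy hxy => ?_) (fun x hx y hy hxy => ?_) (fun x hx => ?_)
        (fun x hx y hy hxy => ?_) (fun x hx y hy hxy => ?_)
      all_goals
        obtain ⟨hgx, hx'⟩ := hg x hx
        have hs := (H a _ hgx.1).1
      rotate_left 2
      · positivity
      all_goals
        obtain ⟨hgy, hy'⟩ := hg y hy
        have hH := (H a _ hgx.1).2 _ hgy.1
        rw [hx', hy'] at hH
      · exact (hH.1 hxy).2.2.1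
      · exact (hH.2 hxy).1
      · rw [div_mul_eq_mul_div, one_mul, div_le_iff₀ (by positivity), mul_comm (dist _ _)]
        exact (hH.1 hxy).2.1
      · have h1 := (hH.1 hxy).1
        rw [show K * (1 / (K * scale a (J a (g x)))) * dist x y =
          dist x y / scale a (J a (g x)) by field_simp, le_div_iff₀ hs, mul_comm]
        exact h1
    · rintro _ ⟨x, hx, rfl⟩
      by_cases hxV : p.eval x ∈ V
      · exact Or.inl hxV
      · obtain ⟨a, ha⟩ := hcov x hxV
        exact Or.inr (Set.mem_iUnion.2 ⟨a, x, ⟨ha, hx⟩, rfl⟩)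

end Polynomial

theorem theorem1p1 (p : Polynomial ℂ) (hp : ∀ a : ℂ, p ≠ Polynomial.C a) (X : Set ℂ) :
    ndim ((fun z : ℂ => p.eval z) '' X) = ndim X := by
  have hd : p.derivative ≠ 0 := fun h =>
    hp _ (Polynomial.eq_C_of_natDegree_eq_zero (Polynomial.derivative_eq_zero.1 h))
  exact ndim_eq_of_colorBound_iff (Polynomial.colorBound_image_iff hd X)
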